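/- There is an absolute constant $C$ such that the following holds for all $d\ge 2$ and all $d'$. Let $T$ be a quantum channel (completely positive trace-preserving linear map) from states on $\mathbb{C}^d$ to states on $\mathbb{C}^{d'}$. Let $\tau=(T\otimes\mathrm{id})(|\Omega\rangle\langle\Omega|)$, with $|\Omega\rangle=\frac1{\sqrt d}\sum_{i=1}^d|i\,i\rangle$, be its Choi state, let $\pi=T(\mathbb{I}/d)$, and let $\mathrm{Tr}_2$ be the partial trace over the input copy (second factor) of $\mathbb{C}^{d'}\otimes\mathbb{C}^d$. A unitary $2$-design is a probability measure $\mu$ on $U(d)$ such that $\mathbb{E}_{U\sim\mu}[P(U)]=\mathbb{E}_{U\sim\mu_{\mathrm{Haar}}}[P(U)]$ for every polynomial $P$ of degree at most $2$ in the entries of $U$ and of degree at most $2$ in the entries of $U^\dagger$. Let $\nu$ be a $2$-design over pure states on $\mathbb{C}^d$, i.e. the distribution of $U|\phi_0\rangle\langle\phi_0|U^\dagger$ for some fixed unit vector $|\phi_0\rangle$ and $U$ drawn from some unitary $2$-design. Then two independent states $\rho,\sigma\sim\nu$ are different with positive probability, so that the law $\nu^{(2)}$ of $(\rho,\sigma)\sim\nu\times\nu$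 conditioned on $\rho\neq\sigma$ is well defined, the ratio below is $\nu^{(2)}$-integrable, and the average contraction of the trace distance satisfies $$\eta_1(T,\|\cdot\|_1,\nu^{(2)})=\mathbb{E}_{(\rho,\sigma)\sim\nu^{(2)}}\left[\frac{\frac12\|T(\rho)-T(\sigma)\|_1}{\frac12\|\rho-\sigma\|_1}\right]\;\le\;\frac12\,\mathrm{Tr}\left[\left(\frac{2}{d+1}\left[d\,\mathrm{Tr}_2\tau^2-\pi^2\right]\right)^{1/2}\right]+\frac{C}{\sqrt d}.$$ -/

import Mathlib

noncomputable section

namespace QuantumContraction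

open MeasureTheory Matrix
open scoped ComplexOrder MatrixOrder

/-- The square root of a positive semidefinite complex matrix. -/
def matrixSqrt {n : ℕ} (A : Matrix (Fin n) (Fin n) ℂ) : Matrix (Fin n) (Fin n) ℂ :=
  CFC.sqrt A

/-- The Schatten 1-norm `Tr √(X† X)`, i.e. the sum of the singular values of `X`. -/
def traceNorm {n : ℕ} (X : Matrix (Fin n) (Fin n) ℂ) : ℝ :=
  (matrixSqrt (Xᴴ * X)).trace.re

/-- The set of quantum states on the `d`-dimensional Hilbert space. -/
def DensityMatrix (d : ℕ) : Type :=
  {ρ : Matrix (Fin d) (Fin d) ℂ // ρ.PosSemidef ∧ ρ.trace = 1}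

instance (d : ℕ) : TopologicalSpace (DensityMatrix d) :=
  inferInstanceAs (TopologicalSpace {ρ : Matrix (Fin d) (Fin d) ℂ // ρ.PosSemidef ∧ ρ.trace = 1})

instance (d : ℕ) : MeasurableSpace (DensityMatrix d) := borel _

instance (d : ℕ) : BorelSpace (DensityMatrix d) := ⟨rfl⟩

/-- The trace distance `½ ‖ρ - σ‖₁`. -/
def traceDist (n : ℕ) (ρ σ : DensityMatrix n) : ℝ := 1 / 2 * traceNorm (ρ.1 - σ.1)

/-- The ampliation `T ⊗ id_k`, acting on matrices over `ℂ^d ⊗ ℂ^k`. -/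
def ampliation {d d' : ℕ} (T : Matrix (Fin d) (Fin d) ℂ →ₗ[ℂ] Matrix (Fin d') (Fin d') ℂ) (k : ℕ)
    (X : Matrix (Fin d × Fin k) (Fin d × Fin k) ℂ) :
    Matrix (Fin d' × Fin k) (Fin d' × Fin k) ℂ :=
  Matrix.of fun p q => T (Matrix.of fun i j => X (i, p.2) (j, q.2)) p.1 q.1

/-- Quantum channels: completely positive trace preserving linear maps. -/
structure Channel (d d' : ℕ) where
  toLin : Matrix (Fin d) (Fin d) ℂ →ₗ[ℂ] Matrix (Fin d') (Fin d') ℂ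
  completelyPositive : ∀ (k : ℕ) (X : Matrix (Fin d × Fin k) (Fin d × Fin k) ℂ),
    X.PosSemidef → (ampliation toLin k X).PosSemidef
  tracePreserving : ∀ X, (toLin X).trace = X.trace

theorem Channel.map_posSemidef {d d' : ℕ} (T : Channel d d') {X : Matrix (Fin d) (Fin d) ℂ}
    (hX : X.PosSemidef) : (T.toLin X).PosSemidef :=
  (T.completelyPositive 1 (X.submatrix Prod.fst Prod.fst) (hX.submatrix _)).submatrix
    (fun i : Fin d' => (i, (0 : Fin 1)))

/-- The action of a channel on states. -/
def Channel.onState {d d' : ℕ} (T : Channel d d') (ρ : DensityMatrix d) : DensityMatrix d' :=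
  ⟨T.toLin ρ.1, T.map_posSemidef ρ.2.1, (T.tracePreserving ρ.1).trans ρ.2.2⟩

/-- The maximally entangled vector `d^(-1/2) ∑ i, |i i⟩`. -/
def maxEntangled (d : ℕ) : Fin d × Fin d → ℂ :=
  fun p => if p.1 = p.2 then ((1 / Real.sqrt d : ℝ) : ℂ) else 0

/-- The Choi state `τ = (T ⊗ id)(|Ω⟩⟨Ω|)`. -/
def Channel.choi {d d' : ℕ} (T : Channel d d') : Matrix (Fin d' × Fin d) (Fin d' × Fin d) ℂ :=
  ampliation T.toLin d (vecMulVec (maxEntangled d) (star (maxEntangled d)))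

/-- The image `π = T(𝟙 / d)` of the maximally mixed state. -/
def Channel.avgOutput {d d' : ℕ} (T : Channel d d') : Matrix (Fin d') (Fin d') ℂ :=
  T.toLin ((d : ℂ)⁻¹ • (1 : Matrix (Fin d) (Fin d) ℂ))

/-- The partial trace over the second tensor factor. -/
def partialTraceSnd {m n : ℕ} (X : Matrix (Fin m × Fin n) (Fin m × Fin n) ℂ) :
    Matrix (Fin m) (Fin m) ℂ :=
  Matrix.of fun a b => ∑ i, X (a, i) (b, i)

/-- The unitary group `U(d)`, with its Borel sigma-algebra below. -/
abbrev UGroup (d : ℕ) : Type := Matrix.unitaryGroup (Fin d) ℂ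

instance (d : ℕ) : MeasurableSpace (UGroup d) := borel _

instance (d : ℕ) : BorelSpace (UGroup d) := ⟨rfl⟩

instance (d : ℕ) : CompactSpace (UGroup d) := by
  refine isCompact_iff_compactSpace.mp ?_
  have hc : IsCompact (Set.univ.pi fun _ : Fin d => Set.univ.pi fun _ : Fin d =>
      Metric.closedBall (0 : ℂ) 1) :=
    isCompact_univ_pi fun _ => isCompact_univ_pi fun _ => isCompact_closedBall _ _
  refine hc.of_isClosed_subset ?_ fun U hU i _ j _ => ?_
  · have : ((Matrix.unitaryGroup (Fin d) ℂ : Submonoid (Matrix (Fin d) (Fin d) ℂ)) :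
        Set (Matrix (Fin d) (Fin d) ℂ)) = {U | U * star U = 1} := by
      ext U
      exact Matrix.mem_unitaryGroup_iff
    rw [this]
    exact isClosed_eq (by fun_prop) continuous_const
  · simpa using entry_norm_bound_of_unitary hU i j

/-- The Haar probability measure on `U(d)`. -/
def haarU (d : ℕ) : Measure (UGroup d) := Measure.haarMeasure ⊤

/-- Polynomials in the entries of `U` (left variables) and of `U†` (right variables). -/
abbrev UPolynomial (d : ℕ) : Type := MvPolynomial ((Fin d × Fin d) ⊕ (Fin d × Fin d)) ℂ

/-- Degree at most `t` in the entries of `U` and degree at most `t` in the entries of `U†`. -/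
def UPolynomial.BidegreeLE {d : ℕ} (t : ℕ) (P : UPolynomial d) : Prop :=
  ∀ m ∈ P.support, ∑ x, m (Sum.inl x) ≤ t ∧ ∑ x, m (Sum.inr x) ≤ t

/-- The value of a polynomial at a unitary. -/
def UPolynomial.evalAt {d : ℕ} (P : UPolynomial d) (U : UGroup d) : ℂ :=
  MvPolynomial.eval (Sum.elim (fun x => U.1 x.1 x.2) (fun x => U.1ᴴ x.1 x.2)) P

/-- Unitary `t`-designs. -/
def IsUnitaryDesign {d : ℕ} (t : ℕ) (μ : Measure (UGroup d)) : Prop :=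
  IsProbabilityMeasure μ ∧ ∀ P : UPolynomial d, P.BidegreeLE t →
    ∫ U, P.evalAt U ∂μ = ∫ U, P.evalAt U ∂(haarU d)

/-- The pure state `|ψ⟩⟨ψ|` of a unit vector `ψ`. -/
def pureState {d : ℕ} (ψ : Fin d → ℂ) (hψ : ψ ⬝ᵥ star ψ = 1) : DensityMatrix d :=
  ⟨vecMulVec ψ (star ψ), posSemidef_vecMulVec_self_star ψ, by rw [trace_vecMulVec, hψ]⟩

theorem mulVec_unit {d : ℕ} (U : UGroup d) (φ : Fin d → ℂ) (hφ : φ ⬝ᵥ star φ = 1) :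
    (U.1 *ᵥ φ) ⬝ᵥ star (U.1 *ᵥ φ) = 1 := by
  have h : U.1ᴴ * U.1 = 1 := Matrix.mem_unitaryGroup_iff'.mp U.2
  rw [star_mulVec, dotProduct_comm, ← dotProduct_mulVec, mulVec_mulVec, h, one_mulVec,
    dotProduct_comm, hφ]

/-- The state `U|φ⟩⟨φ|U†`. -/
def orbitState {d : ℕ} (φ : Fin d → ℂ) (hφ : φ ⬝ᵥ star φ = 1) (U : UGroup d) : DensityMatrix d :=
  pureState (U.1 *ᵥ φ) (mulVec_unit U φ hφ)

/-- State `t`-designs, as distributions of pure states: the distribution of `U|φ⟩⟨φ|U†` for a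
fixed unit vector `φ` and `U` drawn from a unitary `t`-design. -/
def IsStateDesign {d : ℕ} (t : ℕ) (ν : Measure (DensityMatrix d)) : Prop :=
  ∃ (φ : Fin d → ℂ) (hφ : φ ⬝ᵥ star φ = 1) (μ : Measure (UGroup d)),
    IsUnitaryDesign t μ ∧ ν = μ.map (orbitState φ hφ)

/-- The law of a pair of independent states drawn from `ν`, conditioned on being different. -/
def distinctPair {d : ℕ} (ν : Measure (DensityMatrix d)) :
    Measure (DensityMatrix d × DensityMatrix d) :=
  ProbabilityTheory.cond (ν.prod ν) {q | q.1 ≠ q.2}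

/-- The ratio `D(T(ρ), T(σ)) / D(ρ, σ)` for a (finite) divergence `D`. -/
def contractionRatio (D : ∀ n : ℕ, DensityMatrix n → DensityMatrix n → ℝ) {d d' : ℕ}
    (T : Channel d d') (q : DensityMatrix d × DensityMatrix d) : ℝ :=
  D d' (T.onState q.1) (T.onState q.2) / D d q.1 q.2

/-- The `p`-th moment of contraction `η_p(T, D, ν)`; `p = 1` is the average contraction. -/
def contractionMoment (p : ℝ) {d d' : ℕ} (T : Channel d d')
    (D : ∀ n : ℕ, DensityMatrix n → DensityMatrix n → ℝ)
    (ν : Measure (DensityMatrix d × DensityMatrix d)) : ℝ :=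
  (∫ q, contractionRatio D T q ^ p ∂ν) ^ (1 / p)

end QuantumContraction

end

open QuantumContraction MeasureTheory

/-! For pure states, write `F` for the overlap Tr ρσ, `D` for the input trace distance, `D'` for the
output one and `r` for their ratio. Since ρ - σ is traceless, D² ≥ 1 - F, hence D ≥ 1 - F; together
with r ≤ 1 this gives r ≤ D' + F (`contractionRatio_le_add`). So the random denominator can be
dropped at the price of E[F] = 1/d.

The mean of D' is bounded by Jensen's inequality for Tr √·, applied to (T(ρ) - T(σ))²
(`integral_re_trace_matrixSqrt_le`). The mean of that square involves only moments of ρ of order at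
most two, so the design may be replaced by Haar measure. The Haar moments (`haarMoment_eq`) follow
from invariance under diagonal phases and one reflection; the two index pairings become π² and Tr₂
τ² (`IsStateDesign.integral_toLin_mul_self_apply`).

Conditioning on ρ ≠ σ costs at most P(ρ = σ), because the ratio lies in [0, 1]. Equal pure states
have overlap 1, so this probability is at most E[F] = 1/d. The total error is 2/d ≤ 2/√d. -/

namespace QuantumContraction

open Matrix
open scoped ComplexOrder MatrixOrder

/-! ### Jensen's inequality for the trace of the square root -/

section L2
open scoped Matrix.Norms.L2Operator

/-- The operator norm supplies the C*-algebra structure behind the continuity of the square root; it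
induces the usual matrix topology, so the result remains usable outside this section. -/
theorem continuousOn_re_trace_matrixSqrt (n : ℕ) :
    ContinuousOn (fun A : Matrix (Fin n) (Fin n) ℂ => (matrixSqrt A).trace.re) {A | 0 ≤ A} := by
  have h := CFC.continuousOn_sqrt (A := Matrix (Fin n) (Fin n) ℂ)
  have h2 : Continuous (fun A : Matrix (Fin n) (Fin n) ℂ => A.trace.re) := by fun_prop
  exact h2.comp_continuousOn h

/-- The square root is operator concave, and the trace is monotone for the Loewner order. -/
theorem concaveOn_re_trace_matrixSqrt (n : ℕ) :
    ConcaveOn ℝ {A : Matrix (Fin n) (Fin n) ℂ | 0 ≤ A}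
      (fun A : Matrix (Fin n) (Fin n) ℂ => (matrixSqrt A).trace.re) := by
  have h := CFC.concaveOn_sqrt (A := Matrix (Fin n) (Fin n) ℂ)
  refine ⟨h.1, fun x hx y hy a b ha hb hab => ?_⟩
  have h1 := (nonneg_iff_posSemidef.1 (sub_nonneg.2 (h.2 hx hy ha hb hab))).trace_nonneg
  have h2 := (Complex.le_def.1 h1).1
  simp only [trace_sub, trace_add, trace_smul, Complex.sub_re, Complex.add_re,
    Complex.smul_re, Complex.zero_re] at h2
  simp only [matrixSqrt]
  linarith

/-- Jensen's inequality for `Tr √·`, which is concave on positive semidefinite matrices. -/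
theorem integral_re_trace_matrixSqrt_le {Ω : Type*} [MeasurableSpace Ω] {m : Measure Ω}
    [IsProbabilityMeasure m] {n : ℕ} {F : Ω → Matrix (Fin n) (Fin n) ℂ}
    {M : Matrix (Fin n) (Fin n) ℂ}
    (hF : ∀ ω, 0 ≤ F ω) (hi : ∀ i j, Integrable (fun ω => F ω i j) m)
    (hs : Integrable (fun ω => (matrixSqrt (F ω)).trace.re) m)
    (hM : ∀ i j, ∫ ω, F ω i j ∂m = M i j) :
    ∫ ω, (matrixSqrt (F ω)).trace.re ∂m ≤ (matrixSqrt M).trace.re := by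
  -- Expanding in matrix units reduces the matrix-valued integral to the entrywise hypotheses.
  have hF' : ∀ ω, F ω = ∑ i, ∑ j, (F ω i j) • single i j (1 : ℂ) := fun ω => by
    conv_lhs => rw [matrix_eq_sum_single (F ω)]
    simp
  have hint : Integrable F m := by
    rw [funext hF']
    exact integrable_finsetSum _ fun i _ => integrable_finsetSum _ fun j _ => (hi i j).smul_const _
  have hval : ∫ ω, F ω ∂m = M := by
    rw [funext hF', integral_finsetSum _ fun i _ =>
      integrable_finsetSum _ fun j _ => (hi i j).smul_const _]
    conv_rhs => rw [matrix_eq_sum_single M]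
    refine Finset.sum_congr rfl fun i _ => ?_
    rw [integral_finsetSum _ fun j _ => (hi i j).smul_const _]
    refine Finset.sum_congr rfl fun j _ => ?_
    rw [integral_smul_const, hM]; simp
  have hcl : IsClosed {A : Matrix (Fin n) (Fin n) ℂ | 0 ≤ A} := CStarAlgebra.isClosed_nonneg
  have := (concaveOn_re_trace_matrixSqrt n).le_map_integral (continuousOn_re_trace_matrixSqrt n) hcl
    (Filter.Eventually.of_forall hF) hint hs
  rwa [hval] at this

end L2

theorem continuous_traceNorm (n : ℕ) :
    Continuous (traceNorm : Matrix (Fin n) (Fin n) ℂ → ℝ) :=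
  (continuousOn_re_trace_matrixSqrt n).comp_continuous
    (f := fun X : Matrix (Fin n) (Fin n) ℂ => Xᴴ * X) (by fun_prop)
    fun X => nonneg_iff_posSemidef.2 (posSemidef_conjTranspose_mul_self X)

theorem traceNorm_nonneg {n : ℕ} (X : Matrix (Fin n) (Fin n) ℂ) : 0 ≤ traceNorm X :=
  (Complex.le_def.1 (nonneg_iff_posSemidef.1 (CFC.sqrt_nonneg (Xᴴ * X))).trace_nonneg).1

/-! ### Trace norm of Hermitian matrices through eigenvalues -/

section Spectral

variable {n : ℕ} {X : Matrix (Fin n) (Fin n) ℂ} (hX : X.IsHermitian)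

/-- The Hermitian matrix with the eigenvectors of `X` and the prescribed eigenvalues `f`. -/
noncomputable def eigenDiagonal (f : Fin n → ℝ) : Matrix (Fin n) (Fin n) ℂ :=
  (hX.eigenvectorUnitary : Matrix (Fin n) (Fin n) ℂ) * diagonal (fun i => (f i : ℂ)) *
    (hX.eigenvectorUnitary : Matrix (Fin n) (Fin n) ℂ)ᴴ

theorem conjTranspose_eigenvectorUnitary_mul_self :
    (hX.eigenvectorUnitary : Matrix (Fin n) (Fin n) ℂ)ᴴ *
      (hX.eigenvectorUnitary : Matrix (Fin n) (Fin n) ℂ) = 1 :=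
  Unitary.coe_star_mul_self hX.eigenvectorUnitary

theorem eigenDiagonal_eigenvalues : eigenDiagonal hX hX.eigenvalues = X := by
  conv_rhs => rw [hX.spectral_theorem]
  rfl

theorem eigenDiagonal_mul (f g : Fin n → ℝ) :
    eigenDiagonal hX f * eigenDiagonal hX g = eigenDiagonal hX (fun i => f i * g i) := by
  have h : ∀ A B : Matrix (Fin n) (Fin n) ℂ,
      (hX.eigenvectorUnitary : Matrix (Fin n) (Fin n) ℂ) * A *
        (hX.eigenvectorUnitary : Matrix (Fin n) (Fin n) ℂ)ᴴ *
        ((hX.eigenvectorUnitary : Matrix (Fin n) (Fin n) ℂ) * B *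
        (hX.eigenvectorUnitary : Matrix (Fin n) (Fin n) ℂ)ᴴ) =
      (hX.eigenvectorUnitary : Matrix (Fin n) (Fin n) ℂ) * (A * B) *
        (hX.eigenvectorUnitary : Matrix (Fin n) (Fin n) ℂ)ᴴ := fun A B => by
    simp only [Matrix.mul_assoc]
    rw [← Matrix.mul_assoc (hX.eigenvectorUnitary : Matrix (Fin n) (Fin n) ℂ)ᴴ,
      conjTranspose_eigenvectorUnitary_mul_self, Matrix.one_mul]
  simp [eigenDiagonal, h, diagonal_mul_diagonal]

theorem eigenDiagonal_sub (f g : Fin n → ℝ) :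
    eigenDiagonal hX f - eigenDiagonal hX g = eigenDiagonal hX (fun i => f i - g i) := by
  simp [eigenDiagonal, ← Matrix.sub_mul, ← Matrix.mul_sub, diagonal_sub]

theorem trace_eigenDiagonal (f : Fin n → ℝ) :
    (eigenDiagonal hX f).trace = ((∑ i, f i : ℝ) : ℂ) := by
  rw [eigenDiagonal, trace_mul_comm, ← Matrix.mul_assoc, conjTranspose_eigenvectorUnitary_mul_self,
    Matrix.one_mul, trace_diagonal]
  push_cast
  rfl

theorem posSemidef_eigenDiagonal {f : Fin n → ℝ} (hf : ∀ i, 0 ≤ f i) :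
    (eigenDiagonal hX f).PosSemidef :=
  (PosSemidef.diagonal fun i => by simpa using hf i).mul_mul_conjTranspose_same _

theorem traceNorm_eq_sum_abs_eigenvalues : traceNorm X = ∑ i, |hX.eigenvalues i| := by
  have h : matrixSqrt (Xᴴ * X) = eigenDiagonal hX (fun i => |hX.eigenvalues i|) := by
    refine CFC.sqrt_unique ?_
      (nonneg_iff_posSemidef.2 (posSemidef_eigenDiagonal hX fun i => abs_nonneg _))
    rw [hX.eq, eigenDiagonal_mul]
    conv_rhs => rw [← eigenDiagonal_eigenvalues hX, eigenDiagonal_mul]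
    simp only [abs_mul_abs_self]
  rw [traceNorm, h, trace_eigenDiagonal, Complex.ofReal_re]

/-- In an eigenbasis of A - B each eigenvalue is a difference of diagonal entries of A and B. These
are nonnegative, so its absolute value is at most their sum. -/
theorem traceNorm_sub_le {A B : Matrix (Fin n) (Fin n) ℂ} (hA : A.PosSemidef)
    (hB : B.PosSemidef) : traceNorm (A - B) ≤ A.trace.re + B.trace.re := by
  have hX : (A - B).IsHermitian := hA.1.sub hB.1
  set U := (hX.eigenvectorUnitary : Matrix (Fin n) (Fin n) ℂ)
  have htr : ∀ C : Matrix (Fin n) (Fin n) ℂ, C.trace.re = ∑ i, ((Uᴴ * C * U) i i).re := fun C => by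
    rw [← Complex.re_sum]
    change _ = (trace (Uᴴ * C * U)).re
    rw [trace_mul_comm, ← Matrix.mul_assoc,
      mul_eq_one_comm.1 (conjTranspose_eigenvectorUnitary_mul_self hX), Matrix.one_mul]
  have hd : Uᴴ * A * U - Uᴴ * B * U = diagonal (fun i => (hX.eigenvalues i : ℂ)) := by
    rw [← Matrix.sub_mul, ← Matrix.mul_sub]
    conv_lhs => rw [← eigenDiagonal_eigenvalues hX, eigenDiagonal]
    simp only [← Matrix.mul_assoc]
    rw [conjTranspose_eigenvectorUnitary_mul_self, Matrix.one_mul, Matrix.mul_assoc,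
      conjTranspose_eigenvectorUnitary_mul_self, Matrix.mul_one]
  rw [traceNorm_eq_sum_abs_eigenvalues hX, htr A, htr B, ← Finset.sum_add_distrib]
  refine Finset.sum_le_sum fun i _ => ?_
  have h1 : hX.eigenvalues i = ((Uᴴ * A * U) i i).re - ((Uᴴ * B * U) i i).re := by
    rw [← Complex.sub_re, ← Matrix.sub_apply, hd, diagonal_apply_eq, Complex.ofReal_re]
  have ha := (Complex.le_def.1 ((hA.conjTranspose_mul_mul_same U).diag_nonneg (i := i))).1
  have hb := (Complex.le_def.1 ((hB.conjTranspose_mul_mul_same U).diag_nonneg (i := i))).1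
  simp only [Complex.zero_re] at ha hb
  rw [h1, abs_le]
  constructor <;> linarith

/-- The Jordan decomposition into positive and negative parts, which reduces contractivity of
channels to positivity and trace preservation. -/
theorem exists_posSemidef_sub_eq (hX : X.IsHermitian) :
    ∃ P N : Matrix (Fin n) (Fin n) ℂ, P.PosSemidef ∧ N.PosSemidef ∧ X = P - N ∧
      traceNorm X = P.trace.re + N.trace.re := by
  refine ⟨eigenDiagonal hX fun i => max (hX.eigenvalues i) 0,
    eigenDiagonal hX fun i => max (-hX.eigenvalues i) 0,
    posSemidef_eigenDiagonal hX fun i => le_max_right _ _,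
    posSemidef_eigenDiagonal hX fun i => le_max_right _ _, ?_, ?_⟩
  · rw [eigenDiagonal_sub]
    conv_lhs => rw [← eigenDiagonal_eigenvalues hX]
    congr 1
    funext i
    grind
  · rw [traceNorm_eq_sum_abs_eigenvalues hX, trace_eigenDiagonal, trace_eigenDiagonal,
      Complex.ofReal_re, Complex.ofReal_re, ← Finset.sum_add_distrib]
    refine Finset.sum_congr rfl fun i _ => ?_
    grind

/-- The eigenvalues sum to zero, so each one is minus the sum of the others and 2|λᵢ| ≤ ∑ⱼ |λⱼ|.
Multiply by |λᵢ| and sum over i. This avoids diagonalising a rank-two difference of pure states. -/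
theorem two_mul_trace_mul_self_le_sq_traceNorm (hX : X.IsHermitian) (h0 : X.trace = 0) :
    2 * (X * X).trace.re ≤ traceNorm X ^ 2 := by
  have hs : ∑ i, hX.eigenvalues i = 0 := by
    have := trace_eigenDiagonal hX hX.eigenvalues
    rw [eigenDiagonal_eigenvalues, h0] at this
    exact_mod_cast this.symm
  have hq : (X * X).trace.re = ∑ i, hX.eigenvalues i * hX.eigenvalues i := by
    conv_lhs => rw [← eigenDiagonal_eigenvalues hX, eigenDiagonal_mul, trace_eigenDiagonal,
      Complex.ofReal_re]
  rw [traceNorm_eq_sum_abs_eigenvalues hX, hq]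
  set l := hX.eigenvalues
  have hb : ∀ i, 2 * |l i| ≤ ∑ j, |l j| := fun i => by
    rw [← Finset.add_sum_erase _ _ (Finset.mem_univ i)] at hs ⊢
    have : |l i| ≤ ∑ j ∈ Finset.univ.erase i, |l j| := by
      rw [eq_neg_of_add_eq_zero_left hs, abs_neg]
      exact Finset.abs_sum_le_sum_abs _ _
    linarith
  rw [sq, Finset.mul_sum, Finset.sum_mul]
  refine Finset.sum_le_sum fun i _ => ?_
  rw [← abs_mul_abs_self]
  nlinarith [hb i, abs_nonneg (l i)]

end Spectral

/-! ### Pointwise bounds on the contraction ratio -/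

/-- Channels do not increase the trace norm of Hermitian matrices. -/
theorem Channel.traceNorm_map_le {d d' : ℕ} (T : Channel d d') {X : Matrix (Fin d) (Fin d) ℂ}
    (hX : X.IsHermitian) : traceNorm (T.toLin X) ≤ traceNorm X := by
  obtain ⟨P, N, hP, hN, rfl, h⟩ := exists_posSemidef_sub_eq hX
  rw [h, map_sub, ← T.tracePreserving P, ← T.tracePreserving N]
  exact traceNorm_sub_le (T.map_posSemidef hP) (T.map_posSemidef hN)

theorem one_sub_trace_mul_le_sq_traceDist {d : ℕ} (ρ σ : DensityMatrix d)
    (hρ : (ρ.1 * ρ.1).trace = 1) (hσ : (σ.1 * σ.1).trace = 1) :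
    1 - (ρ.1 * σ.1).trace.re ≤ traceDist d ρ σ ^ 2 := by
  have h := two_mul_trace_mul_self_le_sq_traceNorm (ρ.2.1.1.sub σ.2.1.1)
    (by rw [trace_sub, ρ.2.2, σ.2.2, sub_self])
  rw [Matrix.sub_mul, Matrix.mul_sub, Matrix.mul_sub, trace_sub, trace_sub, trace_sub, hρ, hσ,
    trace_mul_comm σ.1 ρ.1] at h
  simp only [Complex.sub_re, Complex.one_re] at h
  rw [traceDist, mul_pow]
  linarith

theorem contractionRatio_nonneg {d d' : ℕ} (T : Channel d d')
    (q : DensityMatrix d × DensityMatrix d) : 0 ≤ contractionRatio traceDist T q :=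
  div_nonneg (mul_nonneg (by norm_num) (traceNorm_nonneg _))
    (mul_nonneg (by norm_num) (traceNorm_nonneg _))

theorem contractionRatio_le_one {d d' : ℕ} (T : Channel d d')
    (q : DensityMatrix d × DensityMatrix d) : contractionRatio traceDist T q ≤ 1 := by
  -- This also covers equal states, where the ratio is 0 by the convention for division by zero.
  refine div_le_one_of_le₀ ?_ (mul_nonneg (by norm_num) (traceNorm_nonneg _))
  have := T.traceNorm_map_le (q.1.2.1.1.sub q.2.2.1.1)
  rw [map_sub] at this
  exact mul_le_mul_of_nonneg_left this (by norm_num)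

/-- From D ≥ 1 - F one gets r(1 - F) ≤ rD ≤ D', and rF ≤ F because r ≤ 1. -/
theorem contractionRatio_le_add {d d' : ℕ} (T : Channel d d')
    (q : DensityMatrix d × DensityMatrix d) (h1 : (q.1.1 * q.1.1).trace = 1)
    (h2 : (q.2.1 * q.2.1).trace = 1) (h0 : 0 ≤ (q.1.1 * q.2.1).trace.re) :
    contractionRatio traceDist T q ≤
      traceDist d' (T.onState q.1) (T.onState q.2) + (q.1.1 * q.2.1).trace.re := by
  have h := one_sub_trace_mul_le_sq_traceDist q.1 q.2 h1 h2
  have hr := contractionRatio_le_one T q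
  have hr0 := contractionRatio_nonneg T q
  have hD : 0 ≤ traceDist d q.1 q.2 := mul_nonneg (by norm_num) (traceNorm_nonneg _)
  have hD' : 0 ≤ traceDist d' (T.onState q.1) (T.onState q.2) :=
    mul_nonneg (by norm_num) (traceNorm_nonneg _)
  set D := traceDist d q.1 q.2
  set r := contractionRatio traceDist T q
  set D' := traceDist d' (T.onState q.1) (T.onState q.2)
  set F := (q.1.1 * q.2.1).trace.re
  have hrD : r * D ≤ D' := by
    rcases hD.eq_or_lt with h | h
    · rw [← h]; simpa using hD'
    · exact (div_mul_cancel₀ D' h.ne').le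
  -- If D < 1 - F then D < 1, so D² ≤ D < 1 - F, contradicting `h`.
  have hDF : 1 - F ≤ D := by
    by_contra hc
    push Not at hc
    nlinarith
  nlinarith

/-! ### Second moments of a Haar random unit vector -/

section Haar

variable {d : ℕ}

instance (d : ℕ) : IsProbabilityMeasure (haarU d) :=
  ⟨by simpa [haarU] using Measure.haarMeasure_self
        (K₀ := (⊤ : TopologicalSpace.PositiveCompacts (UGroup d)))⟩

instance (d : ℕ) : (haarU d).IsMulLeftInvariant :=
  inferInstanceAs
    (Measure.haarMeasure (⊤ : TopologicalSpace.PositiveCompacts (UGroup d))).IsMulLeftInvariant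

theorem integrable_of_continuous_of_compactSpace {X E : Type*} [TopologicalSpace X] [CompactSpace X]
    [MeasurableSpace X] [OpensMeasurableSpace X] [NormedAddCommGroup E]
    [SecondCountableTopologyEither X E]
    {μ : Measure X} [IsFiniteMeasure μ] {f : X → E}
    (hf : Continuous f) : Integrable f μ :=
  hf.integrable_of_hasCompactSupport (HasCompactSupport.of_compactSpace f)

/-- Integration against the Haar measure of `U(d)`, as a linear functional. -/
noncomputable def haarExpect (d : ℕ) : C(UGroup d, ℂ) →ₗ[ℂ] ℂ where
  toFun f := ∫ U, f U ∂(haarU d)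
  map_add' f g := integral_add (integrable_of_continuous_of_compactSpace f.continuous)
    (integrable_of_continuous_of_compactSpace g.continuous)
  map_smul' c _ := integral_const_mul c _

/-- The coordinate `U ↦ (U φ)_a`. -/
def orbitCoord (φ : Fin d → ℂ) (a : Fin d) : C(UGroup d, ℂ) where
  toFun U := (U.1 *ᵥ φ) a
  continuous_toFun := by
    have : Continuous fun U : UGroup d => U.1 *ᵥ φ :=
      continuous_subtype_val.matrix_mulVec continuous_const
    exact (continuous_apply a).comp this

/-- The moment `E[ψ_a ψ̄_b ψ_c ψ̄_e]` for a Haar random unit vector `ψ`. -/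
noncomputable def haarMoment (φ : Fin d → ℂ) (a b c e : Fin d) : ℂ :=
  haarExpect d (orbitCoord φ a * star (orbitCoord φ b) * (orbitCoord φ c * star (orbitCoord φ e)))

theorem haarExpect_comp_mul (V : UGroup d) (f : C(UGroup d, ℂ)) :
    haarExpect d (f.comp ⟨fun U => V * U, by fun_prop⟩) = haarExpect d f :=
  integral_mul_left_eq_self (μ := haarU d) f V

theorem orbitCoord_comp_mul (V : UGroup d) (φ : Fin d → ℂ) (a : Fin d) :
    (orbitCoord φ a).comp ⟨fun U => V * U, by fun_prop⟩ = ∑ b, V.1 a b • orbitCoord φ b := by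
  ext U
  simp only [orbitCoord, ContinuousMap.comp_apply, ContinuousMap.coe_mk, ContinuousMap.coe_sum,
    ContinuousMap.coe_smul, Finset.sum_apply, Pi.smul_apply, Submonoid.coe_mul]
  rw [← mulVec_mulVec]
  rfl

/-- `haarMoment` is invariant under the action of the unitary group on the vector. -/
theorem haarMoment_eq_of_unitary (V : UGroup d) (φ : Fin d → ℂ) (a b c e : Fin d) :
    haarMoment φ a b c e = haarExpect d
      ((∑ x, V.1 a x • orbitCoord φ x) * star (∑ x, V.1 b x • orbitCoord φ x) *
        ((∑ x, V.1 c x • orbitCoord φ x) * star (∑ x, V.1 e x • orbitCoord φ x))) := by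
  simp only [← orbitCoord_comp_mul]
  exact (haarExpect_comp_mul V _).symm

/-- The diagonal unitary with entry `i` at position `j` and `1` elsewhere. -/
def phaseUnitary (j : Fin d) : UGroup d :=
  ⟨diagonal fun x => if x = j then Complex.I else 1, by
    rw [mem_unitaryGroup_iff, star_eq_conjTranspose, diagonal_conjTranspose, diagonal_mul_diagonal,
      ← diagonal_one]
    congr 1
    funext x
    by_cases h : x = j <;> simp [h]⟩

theorem sum_phaseUnitary_smul (j a : Fin d) (f : Fin d → C(UGroup d, ℂ)) :
    ∑ x, (phaseUnitary j).1 a x • f x = (if a = j then Complex.I else 1) • f a := by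
  simp [phaseUnitary, diagonal_apply]

theorem haarMoment_phase (φ : Fin d → ℂ) (j a b c e : Fin d) :
    haarMoment φ a b c e =
      ((if a = j then Complex.I else 1) * (if b = j then -Complex.I else 1) *
        ((if c = j then Complex.I else 1) * (if e = j then -Complex.I else 1))) *
        haarMoment φ a b c e := by
  conv_lhs => rw [haarMoment_eq_of_unitary (phaseUnitary j)]
  simp only [sum_phaseUnitary_smul, star_smul, smul_mul_smul_comm, map_smul]
  rw [haarMoment, smul_eq_mul]
  congr 1
  simp only [apply_ite star, star_one, Complex.star_def, Complex.conj_I]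

/-- Unless {a, c} = {b, e} as multisets, some index j occurs more often in {a, c}. The phase i at j
then multiplies the moment by i or i² = -1, so it vanishes. A sign flip would not suffice when a = c
and b = e. -/
theorem haarMoment_eq_zero (φ : Fin d → ℂ) {a b c e : Fin d} (h1 : ¬ (a = b ∧ c = e))
    (h2 : ¬ (a = e ∧ c = b)) : haarMoment φ a b c e = 0 := by
  have key : ∀ j, ((if a = j then Complex.I else 1) * (if b = j then -Complex.I else 1) *
        ((if c = j then Complex.I else 1) * (if e = j then -Complex.I else 1))) ≠ 1 →
        haarMoment φ a b c e = 0 := fun j hj => by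
    by_contra h0
    exact hj (mul_right_cancel₀ h0 ((haarMoment_phase φ j a b c e).symm.trans (one_mul _).symm))
  have hI : Complex.I ≠ 1 := fun h => by simpa using congrArg Complex.re h
  have hn : (-1 : ℂ) ≠ 1 := by norm_num
  have hI2 : Complex.I * Complex.I = -1 := Complex.I_mul_I
  by_cases hab : a = b
  · subst hab
    have hce : ¬ c = e := fun h => h1 ⟨rfl, h⟩
    apply key c
    by_cases hac : a = c
    · subst hac
      simpa [Ne.symm hce] using hI
    · simpa [hac, Ne.symm hce] using hI
  · by_cases hae : a = e
    · subst hae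
      have hcb : ¬ c = b := fun h => h2 ⟨rfl, h⟩
      apply key c
      by_cases hac : a = c
      · subst hac
        simpa [Ne.symm hcb] using hI
      · simpa [hac, Ne.symm hcb] using hI
    · apply key a
      by_cases hca : c = a
      · simp [hca, Ne.symm hab, Ne.symm hae, hn]
      · simpa [hca, Ne.symm hab, Ne.symm hae] using hI

/-- The reflection along `e_a + 2 e_c`. -/
noncomputable def reflectionUnitary {a c : Fin d} (h : a ≠ c) : UGroup d :=
  ⟨1 - (2 / 5 : ℂ) • vecMulVec (Pi.single a 1 + Pi.single c 2) (Pi.single a 1 + Pi.single c 2), by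
    set w : Fin d → ℂ := Pi.single a 1 + Pi.single c 2
    have hw : w ⬝ᵥ w = 5 := by
      simp [w, h, h.symm]; norm_num
    have hs : star w = w := by
      ext x
      simp only [w, Pi.star_apply, Pi.add_apply, Pi.single_apply]
      split_ifs <;> simp
    have hv : (vecMulVec w w)ᴴ = vecMulVec w w := by
      rw [conjTranspose_vecMulVec, hs]
    rw [mem_unitaryGroup_iff, star_eq_conjTranspose, conjTranspose_sub, conjTranspose_smul, hv,
      conjTranspose_one]
    have h2 : vecMulVec w w * vecMulVec w w = (5 : ℂ) • vecMulVec w w := by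
      rw [vecMulVec_mul_vecMulVec, hw]
      simp [vecMulVec_smul]
    simp only [Matrix.sub_mul, Matrix.mul_sub, Matrix.mul_one, Matrix.one_mul, Matrix.smul_mul,
      Matrix.mul_smul, h2]
    simp only [star_div₀, star_ofNat]
    module⟩

/-- The vector e_a + 2e_c yields the 3-4-5 triple: rational entries, all nonzero on the plane of a
and c, so that the two coordinates really mix. -/
theorem sum_reflectionUnitary_left {a c : Fin d} (h : a ≠ c) (f : Fin d → C(UGroup d, ℂ)) :
    ∑ x, (reflectionUnitary h).1 a x • f x = (3 / 5 : ℂ) • f a - (4 / 5 : ℂ) • f c := by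
  simp [reflectionUnitary, vecMulVec_apply, Matrix.one_apply, Pi.single_apply, h, sub_smul,
    Finset.sum_sub_distrib, mul_add, add_smul, Finset.sum_add_distrib, ite_smul]
  module

theorem sum_reflectionUnitary_right {a c : Fin d} (h : a ≠ c) (f : Fin d → C(UGroup d, ℂ)) :
    ∑ x, (reflectionUnitary h).1 c x • f x = -(4 / 5 : ℂ) • f a - (3 / 5 : ℂ) • f c := by
  simp [reflectionUnitary, vecMulVec_apply, Matrix.one_apply, Pi.single_apply, h.symm, sub_smul,
    Finset.sum_sub_distrib, mul_add, add_smul, Finset.sum_add_distrib, ite_smul]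
  module

theorem haarExpect_quartic (φ : Fin d → ℂ) {a c : Fin d} (h : a ≠ c) {p q : ℂ} (hp : star p = p)
    (hq : star q = q) :
    haarExpect d ((p • orbitCoord φ a + q • orbitCoord φ c) *
      star (p • orbitCoord φ a + q • orbitCoord φ c) *
      ((p • orbitCoord φ a + q • orbitCoord φ c) *
      star (p • orbitCoord φ a + q • orbitCoord φ c))) =
      p ^ 4 * haarMoment φ a a a a + q ^ 4 * haarMoment φ c c c c +
        4 * p ^ 2 * q ^ 2 * haarMoment φ a a c c := by
  have hc : ∀ x y z w, haarMoment φ x y z w = haarMoment φ z y x w := fun x y z w => by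
    unfold haarMoment; congr 1; ring
  have hc' : ∀ x y z w, haarMoment φ x y z w = haarMoment φ x w z y := fun x y z w => by
    unfold haarMoment; congr 1; ring
  have hdef : ∀ x y z w, haarMoment φ x y z w = haarExpect d (orbitCoord φ x *
      star (orbitCoord φ y) * (orbitCoord φ z * star (orbitCoord φ w))) := fun _ _ _ _ => rfl
  simp only [star_add, star_smul, hp, hq, add_mul, mul_add, smul_mul_smul_comm, map_add, map_smul,
    ← hdef, smul_eq_mul]
  have h' := h.symm
  -- Of the sixteen terms, six survive: two pure fourth moments and four mixed ones, identified
  -- below by exchanging factors.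
  simp (discharger := simp [h, h']) only [haarMoment_eq_zero φ]
  rw [hc c a a c, hc' a c c a, hc c c a a, hc' a c c a]
  ring

/-- With A, B the two fourth moments and m the mixed one, invariance under the reflection reads 625A
= 81A + 256B + 576m and 625B = 256A + 81B + 576m. Subtracting gives A = B, and then A = 2m. -/
theorem haarMoment_diag (φ : Fin d → ℂ) {a c : Fin d} (h : a ≠ c) :
    haarMoment φ a a a a = 2 * haarMoment φ a a c c ∧
      haarMoment φ c c c c = haarMoment φ a a a a := by
  have h1 := haarMoment_eq_of_unitary (reflectionUnitary h) φ a a a a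
  have h2 := haarMoment_eq_of_unitary (reflectionUnitary h) φ c c c c
  rw [sum_reflectionUnitary_left h, sub_eq_add_neg, ← neg_smul,
    haarExpect_quartic φ h (by simp) (by simp)] at h1
  rw [sum_reflectionUnitary_right h, sub_eq_add_neg, ← neg_smul,
    haarExpect_quartic φ h (by simp) (by simp)] at h2
  constructor <;> grind

theorem sum_haarMoment (φ : Fin d → ℂ) (hφ : φ ⬝ᵥ star φ = 1) :
    ∑ a, ∑ c, haarMoment φ a a c c = 1 := by
  simp only [haarMoment, ← map_sum, ← Finset.mul_sum, ← Finset.sum_mul]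
  have : ∑ a, orbitCoord φ a * star (orbitCoord φ a) = 1 := by
    ext U
    have := mulVec_unit U φ hφ
    simpa [dotProduct, orbitCoord] using this
  rw [this, mul_one]
  change ∫ U, (1 : C(UGroup d, ℂ)) U ∂(haarU d) = 1
  simp

/-- The second moments of a Haar random unit vector. -/
theorem haarMoment_eq (φ : Fin d → ℂ) (hφ : φ ⬝ᵥ star φ = 1) (a b c e : Fin d) :
    haarMoment φ a b c e =
      ((if a = b ∧ c = e then 1 else 0) + (if a = e ∧ c = b then 1 else 0)) / (d * (d + 1)) := by
  have hd : (d : ℂ) ≠ 0 := by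
    have : d ≠ 0 := fun h => by subst h; exact a.elim0
    exact_mod_cast this
  have hd1 : (d : ℂ) + 1 ≠ 0 := by exact_mod_cast d.succ_ne_zero
  set α := haarMoment φ a a a a with hα
  have hdiag : ∀ x, haarMoment φ x x x x = α := fun x => by
    by_cases h : a = x
    · subst h; rfl
    · exact (haarMoment_diag φ h).2
  have hoff : ∀ x y, haarMoment φ x x y y = α / 2 + (if x = y then α / 2 else 0) := fun x y => by
    by_cases h : x = y
    · subst h; simp [hdiag]
    · have := (haarMoment_diag φ h).1
      rw [hdiag] at this
      simp [h]; grind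
  have hs := sum_haarMoment φ hφ
  simp only [hoff, Finset.sum_add_distrib, Finset.sum_const, Finset.sum_ite_eq,
    Finset.mem_univ, if_true, Finset.card_univ, Fintype.card_fin, nsmul_eq_mul] at hs
  -- The normalisation ‖ψ‖⁴ = 1 reads d²·α/2 + d·α/2 = 1.
  have hα' : α = 2 / (d * (d + 1)) := by
    field_simp
    linear_combination 2 * hs
  by_cases h1 : a = b ∧ c = e
  · obtain ⟨rfl, rfl⟩ := h1
    rw [hoff, hα']
    by_cases h : a = c
    · subst h; simp; ring
    · simp [h]; field_simp
  · by_cases h2 : a = e ∧ c = b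
    · obtain ⟨rfl, rfl⟩ := h2
      have : haarMoment φ a c c a = haarMoment φ a a c c := by
        unfold haarMoment; congr 1; ring
      rw [this, hoff, hα']
      have h : ¬ a = c := fun h => h1 ⟨h, h.symm⟩
      simp [h]; field_simp
    · rw [haarMoment_eq_zero φ h1 h2]; simp [h1, h2]

end Haar

/-! ### Moments and integrability for state designs -/

section Design

variable {d : ℕ}

/-- The polynomial `P` with `P(U) = ψ_a ψ̄_b ψ_c ψ̄_e`, where `ψ = U φ`. -/
noncomputable def momentPolynomial (φ : Fin d → ℂ) (a b c e : Fin d) : UPolynomial d :=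
  ∑ t : (Fin d × Fin d) × (Fin d × Fin d), MvPolynomial.monomial
    -- The conjugate of the (b, x) entry of U is the (x, b) entry of U†, hence the transposed
    -- indices.
    (Finsupp.single (Sum.inl (a, t.1.1)) 1 + Finsupp.single (Sum.inr (t.1.2, b)) 1 +
      (Finsupp.single (Sum.inl (c, t.2.1)) 1 + Finsupp.single (Sum.inr (t.2.2, e)) 1))
    (φ t.1.1 * star (φ t.1.2) * (φ t.2.1 * star (φ t.2.2)))

theorem bidegreeLE_momentPolynomial (φ : Fin d → ℂ) (a b c e : Fin d) :
    (momentPolynomial φ a b c e).BidegreeLE 2 := by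
  intro m hm
  obtain ⟨t, -, ht⟩ := Finset.mem_biUnion.1 (MvPolynomial.support_sum hm)
  obtain rfl := Finset.mem_singleton.1 (MvPolynomial.support_monomial_subset ht)
  simp [Finset.sum_add_distrib, Finsupp.single_apply]

theorem orbitCoord_apply (φ : Fin d → ℂ) (a : Fin d) (U : UGroup d) :
    orbitCoord φ a U = ∑ x, U.1 a x * φ x := rfl

theorem evalAt_momentPolynomial (φ : Fin d → ℂ) (a b c e : Fin d) (U : UGroup d) :
    (momentPolynomial φ a b c e).evalAt U = orbitCoord φ a U * star (orbitCoord φ b U) *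
      (orbitCoord φ c U * star (orbitCoord φ e U)) := by
  have hp : ∀ {ι κ : Type} [Fintype ι] [Fintype κ] (f : ι → ℂ) (g : κ → ℂ),
      (∑ x, f x) * ∑ y, g y = ∑ p : ι × κ, f p.1 * g p.2 := fun f g => by
    rw [Finset.sum_mul_sum, Fintype.sum_prod_type]
  simp only [orbitCoord_apply, star_sum, hp, UPolynomial.evalAt, momentPolynomial, map_sum]
  refine Finset.sum_congr rfl fun t _ => ?_
  rw [MvPolynomial.eval_monomial, Finsupp.prod_add_index' (by simp) (by simp [pow_add]),
    Finsupp.prod_add_index' (by simp) (by simp [pow_add]),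
    Finsupp.prod_add_index' (by simp) (by simp [pow_add])]
  simp only [Finsupp.prod_single_index, pow_zero, pow_one, Sum.elim_inl, Sum.elim_inr,
    conjTranspose_apply, star_mul']
  ring

theorem IsUnitaryDesign.integral_orbitCoord {μ : Measure (UGroup d)} (hμ : IsUnitaryDesign 2 μ)
    {φ : Fin d → ℂ} (hφ : φ ⬝ᵥ star φ = 1) (a b c e : Fin d) :
    ∫ U, orbitCoord φ a U * star (orbitCoord φ b U) *
      (orbitCoord φ c U * star (orbitCoord φ e U)) ∂μ =
      ((if a = b ∧ c = e then 1 else 0) + (if a = e ∧ c = b then 1 else 0)) / (d * (d + 1)) := by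
  have h := hμ.2 _ (bidegreeLE_momentPolynomial φ a b c e)
  simp only [evalAt_momentPolynomial] at h
  rw [h]
  exact haarMoment_eq φ hφ a b c e

/-- Second countability makes the product of Borel sigma-algebras Borel, so continuous functions of
a pair of states are measurable. -/
theorem secondCountableTopology_matrix : SecondCountableTopology (Matrix (Fin d) (Fin d) ℂ) :=
  inferInstanceAs (SecondCountableTopology (Fin d → Fin d → ℂ))

instance : SecondCountableTopology (UGroup d) :=
  haveI := secondCountableTopology_matrix (d := d)
  TopologicalSpace.Subtype.secondCountableTopology _

instance : SecondCountableTopology (DensityMatrix d) :=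
  haveI := secondCountableTopology_matrix (d := d)
  TopologicalSpace.Subtype.secondCountableTopology _

instance : T2Space (DensityMatrix d) :=
  inferInstanceAs (T2Space {ρ : Matrix (Fin d) (Fin d) ℂ // ρ.PosSemidef ∧ ρ.trace = 1})

theorem continuous_densityMatrix_val : Continuous fun ρ : DensityMatrix d => ρ.1 :=
  continuous_subtype_val

theorem continuous_orbitState (φ : Fin d → ℂ) (hφ : φ ⬝ᵥ star φ = 1) :
    Continuous (orbitState φ hφ) := by
  have h : Continuous fun U : UGroup d => U.1 *ᵥ φ :=
    continuous_subtype_val.matrix_mulVec continuous_const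
  exact Continuous.subtype_mk (h.matrix_vecMulVec h.star) _

variable {ν : Measure (DensityMatrix d)}

theorem IsStateDesign.isProbabilityMeasure {t : ℕ} (hν : IsStateDesign t ν) :
    IsProbabilityMeasure ν := by
  obtain ⟨φ, hφ, μ, hμ, rfl⟩ := hν
  have := hμ.1
  exact Measure.isProbabilityMeasure_map (continuous_orbitState φ hφ).measurable.aemeasurable

/-- Pulled back along the orbit map, the function is continuous on the compact group U(d). -/
theorem IsStateDesign.integrable {t : ℕ} (hν : IsStateDesign t ν) {E : Type*}
    [NormedAddCommGroup E] {f : DensityMatrix d → E} (hf : Continuous f) : Integrable f ν := by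
  obtain ⟨φ, hφ, μ, hμ, rfl⟩ := hν
  have := hμ.1
  have hc := continuous_orbitState φ hφ
  exact (integrable_map_measure hf.aestronglyMeasurable hc.measurable.aemeasurable).2
    (integrable_of_continuous_of_compactSpace (hf.comp hc))

theorem IsStateDesign.integrable_prod {t : ℕ} (hν : IsStateDesign t ν) {E : Type*}
    [NormedAddCommGroup E] {f : DensityMatrix d × DensityMatrix d → E} (hf : Continuous f) :
    Integrable f (ν.prod ν) := by
  obtain ⟨φ, hφ, μ, hμ, rfl⟩ := hν
  have := hμ.1
  have hc := continuous_orbitState φ hφ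
  rw [Measure.map_prod_map _ _ hc.measurable hc.measurable]
  exact (integrable_map_measure hf.aestronglyMeasurable
    (hc.measurable.prodMap hc.measurable).aemeasurable).2
    (integrable_of_continuous_of_compactSpace (hf.comp (hc.prodMap hc)))

theorem IsStateDesign.integral_mul (hν : IsStateDesign 2 ν) (a b c e : Fin d) :
    ∫ ρ, ρ.1 a b * ρ.1 c e ∂ν =
      ((if a = b ∧ c = e then 1 else 0) + (if a = e ∧ c = b then 1 else 0)) / (d * (d + 1)) := by
  obtain ⟨φ, hφ, μ, hμ, rfl⟩ := hν
  have hc : Continuous fun ρ : DensityMatrix d => ρ.1 a b * ρ.1 c e :=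
    (continuous_densityMatrix_val.matrix_elem a b).mul
      (continuous_densityMatrix_val.matrix_elem c e)
  rw [integral_map (continuous_orbitState φ hφ).measurable.aemeasurable hc.aestronglyMeasurable]
  exact hμ.integral_orbitCoord hφ a b c e

/-- Inserting the factor Tr ρ = 1 turns the first moment into a sum of second moments. -/
theorem IsStateDesign.integral_apply (hν : IsStateDesign 2 ν) (a b : Fin d) :
    ∫ ρ, ρ.1 a b ∂ν = if a = b then (d : ℂ)⁻¹ else 0 := by
  have hd : (d : ℂ) ≠ 0 := by
    have : d ≠ 0 := fun h => by subst h; exact a.elim0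
    exact_mod_cast this
  have hd1 : (d : ℂ) + 1 ≠ 0 := by exact_mod_cast d.succ_ne_zero
  have h : ∀ ρ : DensityMatrix d, ρ.1 a b = ∑ c, ρ.1 a b * ρ.1 c c := fun ρ => by
    rw [← Finset.mul_sum]
    exact (mul_one _).symm.trans (congrArg _ ρ.2.2.symm)
  rw [integral_congr_ae (Filter.Eventually.of_forall h), integral_finsetSum]
  · simp only [hν.integral_mul, ← Finset.sum_div, Finset.sum_add_distrib]
    by_cases hab : a = b
    · subst hab
      simp [Finset.sum_ite_eq, eq_comm]
      field_simp
    · have : ∀ x, ¬ (a = x ∧ x = b) := fun x hx => hab (hx.1.trans hx.2)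
      simp [hab, this]
  · intro c _
    exact hν.integrable ((continuous_densityMatrix_val.matrix_elem a b).mul
      (continuous_densityMatrix_val.matrix_elem c c))

theorem IsStateDesign.ae_trace_mul_self {t : ℕ} (hν : IsStateDesign t ν) :
    ∀ᵐ ρ ∂ν, (ρ.1 * ρ.1).trace = 1 := by
  obtain ⟨φ, hφ, μ, hμ, rfl⟩ := hν
  have hc := continuous_densityMatrix_val (d := d)
  refine (ae_map_iff (continuous_orbitState φ hφ).measurable.aemeasurable
    (isClosed_eq (hc.mul hc).matrix_trace continuous_const).measurableSet).2 ?_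
  refine Filter.Eventually.of_forall fun U => ?_
  have h := mulVec_unit U φ hφ
  change (vecMulVec (U.1 *ᵥ φ) (star (U.1 *ᵥ φ)) * vecMulVec (U.1 *ᵥ φ) (star (U.1 *ᵥ φ))).trace = 1
  rw [vecMulVec_mul_vecMulVec, dotProduct_comm, h, one_smul, trace_vecMulVec, h]

end Design

/-! ### Choi state and mean square of the output difference -/

theorem trace_mul_nonneg {n : ℕ} {A B : Matrix (Fin n) (Fin n) ℂ} (hA : A.PosSemidef)
    (hB : B.PosSemidef) : 0 ≤ (A * B).trace := by
  obtain ⟨C, rfl⟩ := CStarAlgebra.nonneg_iff_eq_star_mul_self.mp hA.nonneg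
  rw [Matrix.mul_assoc, trace_mul_comm, Matrix.mul_assoc, ← Matrix.mul_assoc C]
  exact (hB.mul_mul_conjTranspose_same C).trace_nonneg

variable {d d' : ℕ}

/-- The image of the matrix unit `|a⟩⟨b|`. -/
def Channel.unit (T : Channel d d') (a b : Fin d) : Matrix (Fin d') (Fin d') ℂ :=
  T.toLin (single a b 1)

theorem Channel.toLin_eq_sum (T : Channel d d') (X : Matrix (Fin d) (Fin d) ℂ) :
    T.toLin X = ∑ a, ∑ b, X a b • T.unit a b := by
  conv_lhs => rw [matrix_eq_sum_single X]
  simp only [map_sum, Channel.unit, ← map_smul, smul_single, smul_eq_mul, mul_one]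

theorem Channel.avgOutput_eq (T : Channel d d') :
    T.avgOutput = (d : ℂ)⁻¹ • ∑ a, T.unit a a := by
  rw [Channel.avgOutput, map_smul, T.toLin_eq_sum]
  simp [Matrix.one_apply, ite_smul]

theorem Channel.choi_apply (T : Channel d d') (p q : Fin d') (a b : Fin d) :
    T.choi (p, a) (q, b) = (d : ℂ)⁻¹ * T.unit a b p q := by
  have hs : ((1 / Real.sqrt d : ℝ) : ℂ) * ((1 / Real.sqrt d : ℝ) : ℂ) = (d : ℂ)⁻¹ := by
    rw [← Complex.ofReal_mul, one_div, ← mul_inv, Real.mul_self_sqrt (Nat.cast_nonneg d)]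
    simp
  have h : (Matrix.of fun i j : Fin d =>
      vecMulVec (maxEntangled d) (star (maxEntangled d)) (i, a) (j, b)) =
      (d : ℂ)⁻¹ • single a b (1 : ℂ) := by
    ext i j
    simp only [of_apply, vecMulVec_apply, maxEntangled, Pi.star_apply, apply_ite star, star_zero,
      Complex.star_def, Complex.conj_ofReal, Matrix.smul_apply, single_apply, smul_eq_mul, ← hs]
    by_cases h1 : i = a <;> by_cases h2 : j = b <;> simp [h1, h2, @eq_comm _ a i, @eq_comm _ b j]
  simp only [Channel.choi, ampliation, of_apply]
  rw [h, map_smul]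
  rfl

theorem Channel.partialTraceSnd_choi_mul_self (T : Channel d d') :
    partialTraceSnd (T.choi * T.choi) =
      ((d : ℂ)⁻¹ * (d : ℂ)⁻¹) • ∑ a, ∑ b, T.unit a b * T.unit b a := by
  ext p q
  simp only [partialTraceSnd, of_apply, Matrix.mul_apply, Fintype.sum_prod_type, T.choi_apply,
    Matrix.smul_apply, Matrix.sum_apply, smul_eq_mul, Finset.mul_sum]
  refine Finset.sum_congr rfl fun a _ => ?_
  rw [Finset.sum_comm]
  refine Finset.sum_congr rfl fun b _ => Finset.sum_congr rfl fun r _ => ?_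
  ring

variable {ν : Measure (DensityMatrix d)}

theorem Channel.continuous_toLin_val (T : Channel d d') :
    Continuous fun ρ : DensityMatrix d => T.toLin ρ.1 :=
  T.toLin.continuous_of_finiteDimensional.comp continuous_densityMatrix_val

theorem IsStateDesign.integral_toLin_apply (hν : IsStateDesign 2 ν) (T : Channel d d')
    (p q : Fin d') : ∫ ρ, T.toLin ρ.1 p q ∂ν = T.avgOutput p q := by
  have hc : ∀ a b, Integrable (fun ρ : DensityMatrix d => ρ.1 a b * T.unit a b p q) ν := fun a b =>
    hν.integrable ((continuous_densityMatrix_val.matrix_elem a b).mul continuous_const)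
  simp only [T.toLin_eq_sum, T.avgOutput_eq, Matrix.sum_apply, Matrix.smul_apply, smul_eq_mul]
  rw [integral_finsetSum _ fun a _ => integrable_finsetSum _ fun b _ => hc a b, Finset.mul_sum]
  refine Finset.sum_congr rfl fun a _ => ?_
  rw [integral_finsetSum _ fun b _ => hc a b]
  simp [integral_mul_const, hν.integral_apply, ite_mul]

/-- Expand T(ρ)² in images of matrix units. The pairing a = b, c = e contributes d²π² and the
crossed pairing contributes d² Tr₂ τ²; dividing by d(d + 1) leaves the factor d/(d + 1). -/
theorem IsStateDesign.integral_toLin_mul_self_apply (hν : IsStateDesign 2 ν) (T : Channel d d')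
    (hd : d ≠ 0) (p q : Fin d') : ∫ ρ, (T.toLin ρ.1 * T.toLin ρ.1) p q ∂ν =
      ((d / (d + 1) : ℂ) •
        (T.avgOutput * T.avgOutput + partialTraceSnd (T.choi * T.choi))) p q := by
  have hd0 : (d : ℂ) ≠ 0 := by exact_mod_cast hd
  have hd1 : (d : ℂ) + 1 ≠ 0 := by exact_mod_cast d.succ_ne_zero
  have hexp : ∀ ρ : DensityMatrix d, (T.toLin ρ.1 * T.toLin ρ.1) p q =
      ∑ a, ∑ b, ∑ c, ∑ e, (ρ.1 a b * ρ.1 c e) * (T.unit a b * T.unit c e) p q := fun ρ => by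
    have hm : T.toLin ρ.1 * T.toLin ρ.1 =
        ∑ a, ∑ b, ∑ c, ∑ e, (ρ.1 a b * ρ.1 c e) • (T.unit a b * T.unit c e) := by
      rw [T.toLin_eq_sum, Finset.sum_mul]
      refine Finset.sum_congr rfl fun a _ => ?_
      rw [Finset.sum_mul]
      refine Finset.sum_congr rfl fun b _ => ?_
      rw [Finset.mul_sum]
      refine Finset.sum_congr rfl fun c _ => ?_
      rw [Finset.mul_sum]
      exact Finset.sum_congr rfl fun e _ => smul_mul_smul_comm _ _ _ _
    rw [hm]
    simp only [Matrix.sum_apply, Matrix.smul_apply, smul_eq_mul]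
  have hc : ∀ a b c e, Integrable (fun ρ : DensityMatrix d =>
      (ρ.1 a b * ρ.1 c e) * (T.unit a b * T.unit c e) p q) ν := fun a b c e =>
    hν.integrable (((continuous_densityMatrix_val.matrix_elem a b).mul
      (continuous_densityMatrix_val.matrix_elem c e)).mul continuous_const)
  have hint : ∫ ρ, (T.toLin ρ.1 * T.toLin ρ.1) p q ∂ν = ∑ a, ∑ b, ∑ c, ∑ e,
      ((if a = b ∧ c = e then 1 else 0) + (if a = e ∧ c = b then 1 else 0)) / (d * (d + 1)) *
        (T.unit a b * T.unit c e) p q := by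
    simp only [hexp]
    rw [integral_finsetSum _ fun a _ => integrable_finsetSum _ fun b _ =>
      integrable_finsetSum _ fun c _ => integrable_finsetSum _ fun e _ => hc a b c e]
    refine Finset.sum_congr rfl fun a _ => ?_
    rw [integral_finsetSum _ fun b _ =>
      integrable_finsetSum _ fun c _ => integrable_finsetSum _ fun e _ => hc a b c e]
    refine Finset.sum_congr rfl fun b _ => ?_
    rw [integral_finsetSum _ fun c _ => integrable_finsetSum _ fun e _ => hc a b c e]
    refine Finset.sum_congr rfl fun c _ => ?_
    rw [integral_finsetSum _ fun e _ => hc a b c e]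
    simp only [integral_mul_const, hν.integral_mul]
  have h1 : ∑ a, ∑ b, ∑ c, ∑ e, (if a = b ∧ c = e then (1 : ℂ) else 0) *
      (T.unit a b * T.unit c e) p q = ((∑ a, T.unit a a) * ∑ c, T.unit c c) p q := by
    simp only [ite_and, ite_mul, one_mul, zero_mul, Finset.sum_mul_sum,
      Matrix.sum_apply]
    refine Finset.sum_congr rfl fun a _ => ?_
    rw [Finset.sum_eq_single a (by intro b _ hb; simp [hb.symm]) (by simp)]
    simp
  have h2 : ∑ a, ∑ b, ∑ c, ∑ e, (if a = e ∧ c = b then (1 : ℂ) else 0) *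
      (T.unit a b * T.unit c e) p q = (∑ a, ∑ b, T.unit a b * T.unit b a) p q := by
    simp only [Matrix.sum_apply]
    refine Finset.sum_congr rfl fun a _ => Finset.sum_congr rfl fun b _ => ?_
    rw [Finset.sum_eq_single b (by intro c _ hc; simp [hc]) (by simp),
      Finset.sum_eq_single a (by intro c _ hc; simp [hc.symm]) (by simp)]
    simp
  have hsplit : ∀ a b c e : Fin d,
      ((if a = b ∧ c = e then (1 : ℂ) else 0) +
        (if a = e ∧ c = b then 1 else 0)) / (d * (d + 1)) * (T.unit a b * T.unit c e) p q =
      (d * (d + 1) : ℂ)⁻¹ * ((if a = b ∧ c = e then (1 : ℂ) else 0) * (T.unit a b * T.unit c e) p q +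
        (if a = e ∧ c = b then 1 else 0) * (T.unit a b * T.unit c e) p q) := fun a b c e => by ring
  rw [hint]
  simp only [hsplit, ← Finset.mul_sum, Finset.sum_add_distrib, h1, h2]
  rw [T.partialTraceSnd_choi_mul_self, T.avgOutput_eq]
  simp only [Matrix.smul_apply, Matrix.add_apply, smul_eq_mul, smul_mul_smul_comm]
  field_simp

/-- The mean of `(T(ρ) - T(σ))²` over two independent states of a `2`-design. -/
theorem IsStateDesign.integral_diff_sq_apply (hν : IsStateDesign 2 ν) (T : Channel d d')
    (hd : d ≠ 0) (p q : Fin d') :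
    ∫ x : DensityMatrix d × DensityMatrix d,
      ((T.toLin x.1.1 - T.toLin x.2.1) * (T.toLin x.1.1 - T.toLin x.2.1)) p q ∂(ν.prod ν) =
      ((2 / ((d : ℂ) + 1)) • ((d : ℂ) • partialTraceSnd (T.choi * T.choi) -
        T.avgOutput * T.avgOutput)) p q := by
  have hd1 : (d : ℂ) + 1 ≠ 0 := by exact_mod_cast d.succ_ne_zero
  have := hν.isProbabilityMeasure
  have hT := T.continuous_toLin_val
  have hT1 : Continuous fun x : DensityMatrix d × DensityMatrix d => T.toLin x.1.1 :=
    hT.comp continuous_fst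
  have hT2 : Continuous fun x : DensityMatrix d × DensityMatrix d => T.toLin x.2.1 :=
    hT.comp continuous_snd
  have hi : ∀ {f g : DensityMatrix d × DensityMatrix d → Matrix (Fin d') (Fin d') ℂ},
      Continuous f → Continuous g → Integrable (fun x => (f x * g x) p q) (ν.prod ν) :=
    fun hf hg => hν.integrable_prod ((hf.matrix_mul hg).matrix_elem p q)
  have hcross : ∫ x : DensityMatrix d × DensityMatrix d,
      (T.toLin x.1.1 * T.toLin x.2.1) p q ∂(ν.prod ν) = (T.avgOutput * T.avgOutput) p q := by
    have hi' : ∀ r, Integrable (fun x : DensityMatrix d × DensityMatrix d =>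
        T.toLin x.1.1 p r * T.toLin x.2.1 r q) (ν.prod ν) := fun r =>
      hν.integrable_prod ((hT1.matrix_elem p r).mul (hT2.matrix_elem r q))
    simp only [Matrix.mul_apply]
    rw [integral_finsetSum _ fun r _ => hi' r]
    refine Finset.sum_congr rfl fun r _ => ?_
    rw [integral_prod_mul (fun ρ : DensityMatrix d => T.toLin ρ.1 p r)
      (fun ρ : DensityMatrix d => T.toLin ρ.1 r q), hν.integral_toLin_apply,
      hν.integral_toLin_apply]
  have hcross' : ∫ x : DensityMatrix d × DensityMatrix d,
      (T.toLin x.2.1 * T.toLin x.1.1) p q ∂(ν.prod ν) = (T.avgOutput * T.avgOutput) p q := by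
    rw [← hcross]
    exact integral_prod_swap (fun x : DensityMatrix d × DensityMatrix d =>
      (T.toLin x.1.1 * T.toLin x.2.1) p q)
  have h1 : ∫ x : DensityMatrix d × DensityMatrix d,
      (T.toLin x.1.1 * T.toLin x.1.1) p q ∂(ν.prod ν) = _ :=
    (integral_fun_fst (fun ρ : DensityMatrix d => (T.toLin ρ.1 * T.toLin ρ.1) p q)).trans
      (by rw [probReal_univ, one_smul, hν.integral_toLin_mul_self_apply T hd])
  have h2 : ∫ x : DensityMatrix d × DensityMatrix d,
      (T.toLin x.2.1 * T.toLin x.2.1) p q ∂(ν.prod ν) = _ :=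
    (integral_fun_snd (fun ρ : DensityMatrix d => (T.toLin ρ.1 * T.toLin ρ.1) p q)).trans
      (by rw [probReal_univ, one_smul, hν.integral_toLin_mul_self_apply T hd])
  have hexp : ∀ x : DensityMatrix d × DensityMatrix d,
      ((T.toLin x.1.1 - T.toLin x.2.1) * (T.toLin x.1.1 - T.toLin x.2.1)) p q =
      ((T.toLin x.1.1 * T.toLin x.1.1) p q - (T.toLin x.2.1 * T.toLin x.1.1) p q) -
      ((T.toLin x.1.1 * T.toLin x.2.1) p q - (T.toLin x.2.1 * T.toLin x.2.1) p q) := fun x => by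
    rw [Matrix.mul_sub, Matrix.sub_mul, Matrix.sub_mul]
    rfl
  simp only [hexp]
  have i1 : Integrable (fun x : DensityMatrix d × DensityMatrix d =>
      (T.toLin x.1.1 * T.toLin x.1.1) p q - (T.toLin x.2.1 * T.toLin x.1.1) p q) (ν.prod ν) :=
    (hi hT1 hT1).sub (hi hT2 hT1)
  have i2 : Integrable (fun x : DensityMatrix d × DensityMatrix d =>
      (T.toLin x.1.1 * T.toLin x.2.1) p q - (T.toLin x.2.1 * T.toLin x.2.1) p q) (ν.prod ν) :=
    (hi hT1 hT2).sub (hi hT2 hT2)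
  rw [integral_sub i1 i2, integral_sub (hi hT1 hT1) (hi hT2 hT1),
    integral_sub (hi hT1 hT2) (hi hT2 hT2), h1, h2, hcross, hcross']
  -- Two square terms and two cross terms: 2d/(d+1)·(π² + Tr₂ τ²) - 2π² = 2/(d+1)·(d Tr₂ τ² - π²).
  simp only [Matrix.smul_apply, Matrix.add_apply, Matrix.sub_apply, smul_eq_mul]
  field_simp
  ring

theorem IsStateDesign.integral_traceDist_onState_le (hν : IsStateDesign 2 ν) (T : Channel d d')
    (hd : d ≠ 0) :
    ∫ x, traceDist d' (T.onState x.1) (T.onState x.2) ∂(ν.prod ν) ≤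
      1 / 2 * (matrixSqrt ((2 / ((d : ℂ) + 1)) • ((d : ℂ) • partialTraceSnd (T.choi * T.choi) -
        T.avgOutput * T.avgOutput))).trace.re := by
  have := hν.isProbabilityMeasure
  have hT := T.continuous_toLin_val
  have hX : Continuous fun x : DensityMatrix d × DensityMatrix d =>
      T.toLin x.1.1 - T.toLin x.2.1 :=
    (hT.comp continuous_fst).sub (hT.comp continuous_snd)
  have hH : ∀ x : DensityMatrix d × DensityMatrix d,
      (T.toLin x.1.1 - T.toLin x.2.1)ᴴ = T.toLin x.1.1 - T.toLin x.2.1 := fun x =>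
    (T.map_posSemidef x.1.2.1).1.sub (T.map_posSemidef x.2.2.1).1
  unfold traceDist
  rw [integral_const_mul]
  refine mul_le_mul_of_nonneg_left ?_ (by norm_num)
  refine integral_re_trace_matrixSqrt_le (F := fun x : DensityMatrix d × DensityMatrix d =>
      (T.toLin x.1.1 - T.toLin x.2.1)ᴴ * (T.toLin x.1.1 - T.toLin x.2.1))
    (fun x => nonneg_iff_posSemidef.2 (posSemidef_conjTranspose_mul_self _))
    (fun i j => ?_) (hν.integrable_prod ((continuous_traceNorm d').comp hX)) fun i j => ?_
  · exact hν.integrable_prod ((hX.matrix_conjTranspose.matrix_mul hX).matrix_elem i j)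
  · simp only [hH]
    exact hν.integral_diff_sq_apply T hd i j

/-! ### Overlap, coincidence probability and the unconditioned average -/

/-- The overlap `Tr ρσ` of two states. -/
def overlap (x : DensityMatrix d × DensityMatrix d) : ℝ := (x.1.1 * x.2.1).trace.re

theorem overlap_nonneg (x : DensityMatrix d × DensityMatrix d) : 0 ≤ overlap x :=
  (Complex.le_def.1 (trace_mul_nonneg x.1.2.1 x.2.2.1)).1

theorem continuous_overlap : Continuous (overlap (d := d)) := by
  have h := continuous_densityMatrix_val (d := d)
  exact Complex.continuous_re.comp
    ((h.comp continuous_fst).matrix_mul (h.comp continuous_snd)).matrix_trace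

/-- By independence the mean overlap is the trace of the square of the mean state 𝟙/d. -/
theorem IsStateDesign.integral_overlap (hν : IsStateDesign 2 ν) (hd : d ≠ 0) :
    ∫ x, overlap x ∂(ν.prod ν) = (d : ℝ)⁻¹ := by
  have := hν.isProbabilityMeasure
  have hd0 : (d : ℂ) ≠ 0 := by exact_mod_cast hd
  have h := continuous_densityMatrix_val (d := d)
  have h1 := h.comp (continuous_fst (Y := DensityMatrix d))
  have h2 := h.comp (continuous_snd (X := DensityMatrix d))
  have hc : ∀ a b, Integrable (fun x : DensityMatrix d × DensityMatrix d =>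
      x.1.1 a b * x.2.1 b a) (ν.prod ν) := fun a b =>
    hν.integrable_prod ((h1.matrix_elem a b).mul (h2.matrix_elem b a))
  have key : ∫ x : DensityMatrix d × DensityMatrix d, (x.1.1 * x.2.1).trace ∂(ν.prod ν) =
      (d : ℂ)⁻¹ := by
    simp only [trace, diag_apply, Matrix.mul_apply]
    rw [integral_finsetSum _ fun a _ => integrable_finsetSum _ fun b _ => hc a b]
    have hs : ∀ a, ∫ x : DensityMatrix d × DensityMatrix d, ∑ b, x.1.1 a b * x.2.1 b a ∂(ν.prod ν)
        = (d : ℂ)⁻¹ * (d : ℂ)⁻¹ := fun a => by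
      rw [integral_finsetSum _ fun b _ => hc a b, Finset.sum_eq_single a]
      · rw [integral_prod_mul (fun ρ : DensityMatrix d => ρ.1 a a)
          (fun ρ : DensityMatrix d => ρ.1 a a), hν.integral_apply, if_pos rfl]
      · intro b _ hb
        rw [integral_prod_mul (fun ρ : DensityMatrix d => ρ.1 a b)
          (fun ρ : DensityMatrix d => ρ.1 b a), hν.integral_apply, if_neg hb.symm, zero_mul]
      · simp
    simp only [hs, Finset.sum_const, Finset.card_univ, Fintype.card_fin, nsmul_eq_mul]
    field_simp
  have hre := integral_re (𝕜 := ℂ) (f := fun x : DensityMatrix d × DensityMatrix d =>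
    (x.1.1 * x.2.1).trace) (μ := ν.prod ν)
    (hν.integrable_prod (h1.matrix_mul h2).matrix_trace)
  rw [key] at hre
  refine Eq.trans hre ?_
  simp [← Complex.ofReal_natCast, ← Complex.ofReal_inv]

theorem measurable_contractionRatio (T : Channel d d') :
    Measurable (contractionRatio traceDist T) := by
  have hT := T.continuous_toLin_val
  have hv := continuous_densityMatrix_val (d := d)
  have h1 : Continuous fun x : DensityMatrix d × DensityMatrix d =>
      traceDist d' (T.onState x.1) (T.onState x.2) :=
    continuous_const.mul ((continuous_traceNorm d').comp
      ((hT.comp continuous_fst).sub (hT.comp continuous_snd)))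
  have h2 : Continuous fun x : DensityMatrix d × DensityMatrix d => traceDist d x.1 x.2 :=
    continuous_const.mul ((continuous_traceNorm d).comp
      ((hv.comp continuous_fst).sub (hv.comp continuous_snd)))
  exact h1.measurable.div h2.measurable

theorem integrable_contractionRatio (T : Channel d d')
    (m : Measure (DensityMatrix d × DensityMatrix d)) [IsFiniteMeasure m] :
    Integrable (contractionRatio traceDist T) m := by
  refine Integrable.of_bound (measurable_contractionRatio T).aestronglyMeasurable 1
    (Filter.Eventually.of_forall fun x => ?_)
  rw [Real.norm_of_nonneg (contractionRatio_nonneg T x)]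
  exact contractionRatio_le_one T x

theorem IsStateDesign.ae_pure {t : ℕ} (hν : IsStateDesign t ν) :
    ∀ᵐ x ∂(ν.prod ν), (x.1.1 * x.1.1).trace = 1 ∧ (x.2.1 * x.2.1).trace = 1 := by
  have := hν.isProbabilityMeasure
  exact (Measure.quasiMeasurePreserving_fst.ae hν.ae_trace_mul_self).and
    (Measure.quasiMeasurePreserving_snd.ae hν.ae_trace_mul_self)

theorem measurableSet_fst_ne_snd :
    MeasurableSet {q : DensityMatrix d × DensityMatrix d | q.1 ≠ q.2} :=
  (isOpen_ne_fun continuous_fst continuous_snd).measurableSet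

/-- Two independent states of a design coincide with probability at most `1/d`. -/
theorem IsStateDesign.measureReal_compl_ne_le (hν : IsStateDesign 2 ν) (hd : d ≠ 0) :
    (ν.prod ν).real {q : DensityMatrix d × DensityMatrix d | q.1 ≠ q.2}ᶜ ≤ (d : ℝ)⁻¹ := by
  have := hν.isProbabilityMeasure
  have hS := measurableSet_fst_ne_snd (d := d)
  -- The indicator of coincidence is dominated by the overlap, which equals 1 on equal pure states
  -- and is nonnegative elsewhere.
  rw [← hν.integral_overlap hd, ← integral_indicator_one hS.compl]
  refine integral_mono_ae ((integrable_const (1 : ℝ)).indicator hS.compl)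
    (hν.integrable_prod continuous_overlap) ?_
  filter_upwards [hν.ae_pure] with x hx
  by_cases h : x.1 = x.2
  · have h1 : overlap x = 1 := by
      rw [overlap, ← h, hx.1, Complex.one_re]
    rw [h1]
    exact Set.indicator_le_self' (fun _ _ => zero_le_one) x
  · rw [Set.indicator_of_notMem (by simpa using h)]
    exact overlap_nonneg x

theorem IsStateDesign.integral_contractionRatio_le (hν : IsStateDesign 2 ν) (T : Channel d d')
    (hd : d ≠ 0) : ∫ x, contractionRatio traceDist T x ∂(ν.prod ν) ≤
      1 / 2 * (matrixSqrt ((2 / ((d : ℂ) + 1)) • ((d : ℂ) • partialTraceSnd (T.choi * T.choi) -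
        T.avgOutput * T.avgOutput))).trace.re + (d : ℝ)⁻¹ := by
  have := hν.isProbabilityMeasure
  have hT := T.continuous_toLin_val
  have h1 : Continuous fun x : DensityMatrix d × DensityMatrix d =>
      traceDist d' (T.onState x.1) (T.onState x.2) :=
    continuous_const.mul ((continuous_traceNorm d').comp
      ((hT.comp continuous_fst).sub (hT.comp continuous_snd)))
  refine le_trans ?_ (add_le_add (hν.integral_traceDist_onState_le T hd)
    (hν.integral_overlap hd).le)
  rw [← integral_add (hν.integrable_prod h1) (hν.integrable_prod continuous_overlap)]
  refine integral_mono_ae (integrable_contractionRatio T _)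
    ((hν.integrable_prod h1).add (hν.integrable_prod continuous_overlap)) ?_
  filter_upwards [hν.ae_pure] with x hx
  exact contractionRatio_le_add T x hx.1 hx.2 (overlap_nonneg x)

/-! ### Conditioning on distinct states, and conclusion -/

/-- With p = m(S) and I the conditional mean, I = pI + (1 - p)I, where pI is the integral over S, at
most the full integral, and I ≤ 1. -/
theorem integral_cond_le_integral_add {Ω : Type*} [MeasurableSpace Ω] {m : Measure Ω}
    [IsProbabilityMeasure m] {S : Set Ω} (hS : MeasurableSet S) (h0 : m S ≠ 0) {f : Ω → ℝ}
    (hf : Integrable f m) (hf0 : ∀ x, 0 ≤ f x) (hf1 : ∀ x, f x ≤ 1) :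
    ∫ x, f x ∂(ProbabilityTheory.cond m S) ≤ ∫ x, f x ∂m + m.real Sᶜ := by
  have hle : ∫ x in S, f x ∂m ≤ m.real S := by
    have := setIntegral_mono_on hf.integrableOn (integrable_const (1 : ℝ)).integrableOn hS
      fun x _ => hf1 x
    simpa using this
  have hle' : ∫ x in S, f x ∂m ≤ ∫ x, f x ∂m :=
    setIntegral_le_integral hf (Filter.Eventually.of_forall hf0)
  have hpos : 0 < m.real S := ENNReal.toReal_pos h0 (measure_ne_top m S)
  have hc : m.real Sᶜ = 1 - m.real S := probReal_compl_eq_one_sub hS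
  rw [ProbabilityTheory.cond, integral_smul_measure, ENNReal.toReal_inv, hc, smul_eq_mul]
  change (m.real S)⁻¹ * _ ≤ _
  have hI : (m.real S)⁻¹ * ∫ x in S, f x ∂m ≤ 1 := by
    rw [inv_mul_le_iff₀ hpos]; linarith
  have hmul : m.real S * ((m.real S)⁻¹ * ∫ x in S, f x ∂m) = ∫ x in S, f x ∂m :=
    mul_inv_cancel_left₀ hpos.ne' _
  have hS1 : m.real S ≤ 1 := measureReal_le_one
  nlinarith

end QuantumContraction

theorem mainTheorem7 :
    ∃ C : ℝ, ∀ (d d' : ℕ), 2 ≤ d → ∀ (T : Channel d d') (ν : Measure (DensityMatrix d)),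
      IsStateDesign 2 ν →
        IsProbabilityMeasure (distinctPair ν) ∧
        Integrable (contractionRatio traceDist T) (distinctPair ν) ∧
        contractionMoment 1 T traceDist (distinctPair ν) ≤
          1 / 2 * (matrixSqrt ((2 / ((d : ℂ) + 1)) •
            ((d : ℂ) • partialTraceSnd (T.choi * T.choi) - T.avgOutput * T.avgOutput))).trace.re
            + C / Real.sqrt d := by
  -- One unit of the constant pays for removing the denominator, the other for the conditioning.
  refine ⟨2, fun d d' hd T ν hν => ?_⟩
  have := hν.isProbabilityMeasure
  have hd0 : d ≠ 0 := by omega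
  have hd2 : (2 : ℝ) ≤ d := by exact_mod_cast hd
  have hS := measurableSet_fst_ne_snd (d := d)
  have hc := hν.measureReal_compl_ne_le hd0
  have hne : (ν.prod ν) {q : DensityMatrix d × DensityMatrix d | q.1 ≠ q.2} ≠ 0 := fun h => by
    have h1 : (ν.prod ν).real {q : DensityMatrix d × DensityMatrix d | q.1 ≠ q.2} = 0 := by
      simp [Measure.real, h]
    -- Almost sure coincidence would force 1 ≤ 1/d, which d ≥ 2 excludes.
    rw [probReal_compl_eq_one_sub hS, h1] at hc
    have := inv_anti₀ (by norm_num) hd2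
    norm_num at this hc
    linarith
  have hP : IsProbabilityMeasure (distinctPair ν) := ProbabilityTheory.cond_isProbabilityMeasure hne
  refine ⟨hP, integrable_contractionRatio T _, ?_⟩
  have hE := integral_cond_le_integral_add hS hne (integrable_contractionRatio T (ν.prod ν))
    (contractionRatio_nonneg T) (contractionRatio_le_one T)
  have hR := hν.integral_contractionRatio_le T hd0
  have hsq : (d : ℝ)⁻¹ ≤ 1 / Real.sqrt d := by
    rw [one_div]
    refine inv_anti₀ (Real.sqrt_pos.2 (by linarith)) ?_
    exact Real.sqrt_le_iff.2 ⟨by linarith, by nlinarith⟩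
  have h2 : 2 / Real.sqrt d = 1 / Real.sqrt d + 1 / Real.sqrt d := by ring
  simp only [contractionMoment, Real.rpow_one, div_one]
  rw [h2]
  have hE' : ∫ q, contractionRatio traceDist T q ∂(distinctPair ν) ≤ _ := hE
  linarith
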